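/- **Operadic categories.** Let $\mathsf{Fin}$ be the category of finite ordinals $\underline n=\{1,\dots,n\}$, $n\ge 0$, and all maps. For $f:\underline m\to\underline n$ and $i\in\underline n$ let $f^{-1}(i)$ be the inverse image, relabelled as a finite ordinal by its order, with order-preserving injection $\varepsilon_{f,i}:f^{-1}(i)\to\underline m$; this gives functors $\varphi_{\underline n,i}:\mathsf{Fin}/\underline n\to\mathsf{Fin}$. An *operadic category* is a category $\mathbb O$ with a chosen terminal object in each connected component (the *chosen local terminals*), a functor $|\cdot|:\mathbb O\to\mathsf{Fin}$ (cardinality), and for each object $X$ and each $i\in|X|$ a functor $\varphi_{X,i}:\mathbb O/X\to\mathbb O$, written $f\mapsto f^{-1}(i)$ on objects and $g\mapsto g_i$ on morphisms, such that: (1) chosen local terminals have cardinality $\underline 1$; (2) all fibres of identities are chosen local terminals; (3) $|\varphi_{X,i}(-)|=\varphi_{|X|,i}(|-|)$; (4) if $U$ is a chosen local terminal, its fibre functor is the domain functor $\mathbb O/U\to\mathbb O$; (5) for $f:Y\to X$, $i\in|X|$ and $j\in|f^{-1}(i)|$, and $g:Z\to Y$ regarded as a morphism $fg\to f$ over $X$,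 one has $(g_i)^{-1}(j)=g^{-1}(\varepsilon_{|f|,i}(j))$, and the analogous equality holds for morphisms of $\mathbb O/Y$. A *quasibijection* is a morphism all of whose fibres are chosen local terminals. A morphism $f$ is *order-preserving* if $|f|$ is monotone. For a commutative square $\tau f=g\sigma$ with $\sigma:T\to T'$, $g:T'\to S'$, $f:T\to S$, $\tau:S\to S'$, the morphism $\sigma$ is *fibrewise order-preserving* with respect to $\tau$ if all induced morphisms of fibres $\sigma_i:(g\sigma)^{-1}(i)\to g^{-1}(i)$, $i\in|S'|$, are order-preserving. A *pita factorisation* of $f$ is a factorisation $f=\eta\pi$ with $\pi$ a quasibijection and $\eta$ order-preserving; it is fibrewise order-preserving if $\pi$ is so in the square $\mathrm{id}\circ f=\eta\circ\pi$. $\mathbb O$ is *strictly factorisable* if every morphism $f$ has a unique fibrewise order-preserving pita factorisation $f=\eta(f)\pi(f)$, through an object $M(f)$, and for all $f:T\to S$, $g:S\to R$ there is a unique morphism $\eta(f/g):M(gf)\to M(g)$ with $\eta(f/g)\,\pi(gf)=\pi(g)\,f$ and $\eta(g)\,\eta(f/g)=\eta(gf)$. **The pita nerve.** Let $\mathbb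 O$ be strictly factorisable. The objects of the category $W(\mathbb O)_n$ are the chains $T_n\xrightarrow{f_n}\cdots\xrightarrow{f_1}T_0$ in $\mathbb O$; its morphisms are the commutative ladders of quasibijections $\sigma_k:T_k\to S_k$ such that each $\sigma_k$ is fibrewise order-preserving with respect to $\sigma_0$ (in the square formed with the composites $T_k\to T_0$ and $S_k\to S_0$). Let $\mathsf i_n:P(\mathbb O)_n\hookrightarrow W(\mathbb O)_n$ be the full subcategory of those chains for which all composites $h_k:T_k\to T_0$ are order-preserving. There is a functor $\mathsf r_n:W(\mathbb O)_n\to P(\mathbb O)_n$ that sends a chain to the chain of the objects $M(h_k)$ and the morphisms $\eta(f_k/h_{k-1}):M(h_k)\to M(h_{k-1})$, and a ladder $(\sigma_k)$ to the ladder of the unique morphisms $\omega_k:M(h_k)\to M(h'_k)$ with $\omega_k\pi(h_k)=\pi(h'_k)\sigma_k$ and $\eta(h'_k)\omega_k=\sigma_0\eta(h_k)$, where $h'_k:S_k\to S_0$ are the composites of the second chain. The quasibijections $\pi(h_k)$ form a natural transformation $\pi_n:\mathrm{id}\Rightarrow\mathsf i_n\mathsf r_n$. Number the objects of a chain in $W(\mathbb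 O)_n$ from the left, so that the $k$-th one is $T_{n-k}$, $0\le k\le n$. Omitting the $i$-th object, with composition, defines functors $W(\mathbb O)_{n+1}\to W(\mathbb O)_n$; for $0\le i\le n$ they restrict to *face operators* $d_i:P(\mathbb O)_{n+1}\to P(\mathbb O)_n$. Repeating the $i$-th object, with an identity, gives *degeneracy operators* $s_i:P(\mathbb O)_n\to P(\mathbb O)_{n+1}$, $0\le i\le n$. Writing $d_\top:W(\mathbb O)_{n+1}\to W(\mathbb O)_n$ for the functor that omits $T_0$, the *top face operator* is $d_{n+1}:=\mathsf r_n\, d_\top\,\mathsf i_{n+1}:P(\mathbb O)_{n+1}\to P(\mathbb O)_n$. On $P(\mathbb O)_{n+2}$ there is the $2$-cell $$\beta_n:\; d_{n+1}d_{n+1}=\mathsf r_n d_\top d_\top\mathsf i_{n+2}\;\Longrightarrow\;\mathsf r_n d_\top\mathsf i_{n+1}\mathsf r_{n+1}d_\top\mathsf i_{n+2}=d_{n+1}d_{n+2},\qquad \beta_n=\mathsf r_n d_\top\,\pi_{n+1}\,d_\top\mathsf i_{n+2}.$$ **Proposition.** Let $\mathbb O$ be a strictly factorisable operadic category in which all quasibijections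 are invertible. Then every category $P(\mathbb O)_n$ is a groupoid, and the pita nerve is a fully coherent pseudo-simplicial groupoid: there is a pseudofunctor $P:\Delta^{\mathrm{op}}\to\mathbf{Gpd}$ with $P([n])=P(\mathbb O)_n$ whose values on the generating cofaces and codegeneracies are exactly the operators $d_i$ and $s_i$ above (the top face operators included), such that the invertible $2$-cells which it attaches to the simplicial identities are as follows: the one attached to the identity $d_{n+1}d_{n+1}=d_{n+1}d_{n+2}$ on $P(\mathbb O)_{n+2}$ is $\beta_n$ for every $n\ge0$, and the ones attached to all other simplicial identities (between face operators, between degeneracy operators, or between a face and a degeneracy operator) are identities. -/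

import Mathlib

open CategoryTheory

universe v u w

namespace PitaNerve



/-! ### The skeletal category of finite sets and its fibre functors -/

/-- Objects of the skeletal category of finite sets: the finite ordinals. -/
structure SkFin where
  /-- The number of elements. -/
  len : ℕ

/-- Arrows of the skeletal category of finite sets are arbitrary maps. -/
instance : Category SkFin where
  Hom m n := Fin m.len → Fin n.len
  id _ := id
  comp f g := g ∘ f

namespace SkFin

/-- The inverse image of `i` under `f`, as a subset of the domain. -/
def preimage {m n : SkFin} (f : m ⟶ n) (i : Fin n.len) : Finset (Fin m.len) :=
  Finset.univ.filter (fun a => f a = i)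

/-- The order-preserving injection of the fibre over `i` (relabelled as a finite ordinal),
with image the inverse image of `i`. -/
def ε {m n : SkFin} (f : m ⟶ n) (i : Fin n.len) : Fin (preimage f i).card ↪o Fin m.len :=
  (preimage f i).orderEmbOfFin rfl

lemma mem_preimage {m n : SkFin} (f : m ⟶ n) (i : Fin n.len) (b : Fin m.len) :
    b ∈ preimage f i ↔ f b = i := by
  unfold preimage
  rw [Finset.mem_filter]
  exact and_iff_right (Finset.mem_univ b)

lemma ε_spec {m n : SkFin} (f : m ⟶ n) (i : Fin n.len) (a : Fin (preimage f i).card) :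
    f (ε f i a) = i :=
  (mem_preimage f i _).1 ((preimage f i).orderEmbOfFin_mem rfl a)

lemma exists_ε {m n : SkFin} (f : m ⟶ n) (i : Fin n.len) (b : Fin m.len) (hb : f b = i) :
    ∃ a, ε f i a = b := by
  have h := (preimage f i).range_orderEmbOfFin rfl
  have hb' : b ∈ (preimage f i : Set (Fin m.len)) := (mem_preimage f i b).2 hb
  rw [← h] at hb'
  exact hb'

/-- The map induced on the fibres over `i` by `g` over `n`: the one with `ε ∘ g_i = g ∘ ε`. -/
noncomputable def fibreMap {n : SkFin} (i : Fin n.len) {f f' : Over n} (g : f ⟶ f')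
    (a : Fin (preimage f.hom i).card) : Fin (preimage f'.hom i).card :=
  Classical.choose (exists_ε f'.hom i (g.left (ε f.hom i a))
    ((congrFun (Over.w g) _).trans (ε_spec f.hom i a)))

lemma ε_fibreMap {n : SkFin} (i : Fin n.len) {f f' : Over n} (g : f ⟶ f')
    (a : Fin (preimage f.hom i).card) :
    ε f'.hom i (fibreMap i g a) = g.left (ε f.hom i a) :=
  Classical.choose_spec (exists_ε f'.hom i (g.left (ε f.hom i a))
    ((congrFun (Over.w g) _).trans (ε_spec f.hom i a)))

/-- The fibre functor `φ_{n,i} : Fin/n ⥤ Fin` of the skeletal category of finite sets. -/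
noncomputable def fibre (n : SkFin) (i : Fin n.len) : Over n ⥤ SkFin where
  obj f := ⟨(preimage f.hom i).card⟩
  map g := fibreMap i g
  map_id f := funext fun a => (ε f.hom i).injective (ε_fibreMap i (𝟙 f) a)
  map_comp {_ _ f''} g g' := funext fun a => (ε f''.hom i).injective
    ((ε_fibreMap i (g ≫ g') a).trans
      ((ε_fibreMap i g' (fibreMap i g a)).trans (congrArg g'.left (ε_fibreMap i g a))).symm)

end SkFin

/-! ### Operadic categories -/

/-- The structure of an operadic category on a category `O`. The axioms are written as equalities
of functors, so that each of them contains both its clause on objects and its clause on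
morphisms. -/
class OperadicCategory (O : Type u) [Category.{v} O] where
  /-- The chosen terminal object of each connected component. -/
  lt : ConnectedComponents O → O
  /-- Each object has a unique morphism to the chosen object of its component. -/
  uniqueToLt (X : O) : Unique (X ⟶ lt (Quotient.mk _ X))
  /-- The cardinality functor. -/
  card : O ⥤ SkFin
  /-- The fibre functors: `fibre X i` takes `f : Y ⟶ X` to `f⁻¹(i)`. -/
  fibre (X : O) (i : Fin (card.obj X).len) : Over X ⥤ O
  /-- Chosen local terminal objects have cardinality `1`. -/
  card_lt (c : ConnectedComponents O) : card.obj (lt c) = ⟨1⟩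
  /-- The fibres of identities are chosen local terminal objects. -/
  fibre_id (X : O) (i : Fin (card.obj X).len) :
    (fibre X i).obj (Over.mk (𝟙 X)) ∈ Set.range lt
  /-- The fibre functors are compatible with those of finite sets. -/
  fibre_card (X : O) (i : Fin (card.obj X).len) :
    fibre X i ⋙ card = Over.post card ⋙ SkFin.fibre (card.obj X) i
  /-- The fibre functor of a chosen local terminal object is the domain functor. -/
  fibre_lt (c : ConnectedComponents O) (i : Fin (card.obj (lt c)).len) :
    fibre (lt c) i = Over.forget (lt c)
  /-- Fibres of fibre maps are fibres: `(g_i)⁻¹(j) = g⁻¹(ε j)` for `g : Z ⟶ Y` over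
  `f : Y ⟶ X` and `j` in the cardinality of `f⁻¹(i)`, and similarly for fibre maps. -/
  fibre_fibre {X : O} (f : Over X) (i : Fin (card.obj X).len)
      (j : Fin (card.obj ((fibre X i).obj f)).len) :
    Over.iteratedSliceBackward f ⋙ Over.post (fibre X i) ⋙ fibre ((fibre X i).obj f) j =
      fibre f.left (SkFin.ε (card.map f.hom) i
        (Fin.cast (congrArg SkFin.len (Functor.congr_obj (fibre_card X i) f)) j))

variable {O : Type u} [Category.{v} O] [OperadicCategory O]

open OperadicCategory

/-- A chosen local terminal object (also called a trivial object). -/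
def IsChosenLocalTerminal (X : O) : Prop :=
  X ∈ Set.range (lt (O := O))

/-- A quasibijection is a morphism all of whose fibres are chosen local terminal objects. -/
def IsQuasibijection {T S : O} (σ : T ⟶ S) : Prop :=
  ∀ i, IsChosenLocalTerminal ((fibre S i).obj (Over.mk σ))

/-- A morphism is order-preserving if its image under the cardinality functor is monotone. -/
def IsOrderPreserving {T S : O} (f : T ⟶ S) : Prop :=
  Monotone (card.map f : Fin (card.obj T).len → Fin (card.obj S).len)

/-- For a commutative square `f ≫ τ = σ ≫ g`, with `σ : T ⟶ T'`, `g : T' ⟶ S'`, `f : T ⟶ S` and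
`τ : S ⟶ S'`: the morphism `σ` is fibrewise order-preserving with respect to `τ` if the morphisms
which it induces from the fibres of `f ≫ τ = σ ≫ g` to the fibres of `g` are order-preserving. -/
def FibrewiseOrderPreserving {T T' S' : O} (σ : T ⟶ T') (g : T' ⟶ S') : Prop :=
  ∀ i, IsOrderPreserving ((fibre S' i).map (Over.homMk σ : Over.mk (σ ≫ g) ⟶ Over.mk g))

lemma monotone_eqToHom_iff {a b c d : SkFin} (h : a = b) (f : b ⟶ c) (h' : c = d) :
    Monotone (eqToHom h ≫ f ≫ eqToHom h' : Fin a.len → Fin d.len) ↔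
      Monotone (f : Fin b.len → Fin c.len) := by
  subst h h'
  simp

lemma card_map_comp_apply {T S R : O} (f : T ⟶ S) (g : S ⟶ R) (a : Fin (card.obj T).len) :
    card.map (f ≫ g) a = card.map g (card.map f a) :=
  congrFun (card.map_comp f g) a

lemma card_map_id_apply {T : O} (a : Fin (card.obj T).len) : card.map (𝟙 T) a = a :=
  congrFun (card.map_id T) a

lemma SkFin.monotone_fibreMap_iff {n : SkFin} {f f' : Over n} (g : f ⟶ f') :
    (∀ i, Monotone (fibreMap i g)) ↔
      ∀ a b : Fin f.left.len, a ≤ b → f.hom a = f.hom b → g.left a ≤ g.left b := by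
  constructor
  · intro h a b hab e
    obtain ⟨a, rfl⟩ := exists_ε f.hom (f.hom b) a e
    obtain ⟨b', hb⟩ := exists_ε f.hom (f.hom b) b rfl
    have hab' : a ≤ b' := (ε f.hom (f.hom b)).le_iff_le.1 (hab.trans hb.ge)
    have h1 := (ε f'.hom (f.hom b)).le_iff_le.2 (h _ hab')
    rw [ε_fibreMap, ε_fibreMap] at h1
    exact h1.trans (congrArg g.left hb).le
  · intro h i a b hab
    apply (ε f'.hom i).le_iff_le.1
    rw [ε_fibreMap, ε_fibreMap]
    exact h _ _ ((ε f.hom i).le_iff_le.2 hab) ((ε_spec f.hom i a).trans (ε_spec f.hom i b).symm)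

lemma fibrewiseOrderPreserving_iff {T T' S' : O} (σ : T ⟶ T') (g : T' ⟶ S') :
    FibrewiseOrderPreserving σ g ↔ ∀ a b : Fin (card.obj T).len, a ≤ b →
      card.map g (card.map σ a) = card.map g (card.map σ b) →
        card.map σ a ≤ card.map σ b := by
  have key : ∀ i, IsOrderPreserving
      ((fibre S' i).map (Over.homMk σ : Over.mk (σ ≫ g) ⟶ Over.mk g)) ↔
      Monotone (SkFin.fibreMap i
        ((Over.post card).map (Over.homMk σ : Over.mk (σ ≫ g) ⟶ Over.mk g))) := by
    intro i
    have := Functor.congr_hom (fibre_card S' i) (Over.homMk σ : Over.mk (σ ≫ g) ⟶ Over.mk g)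
    unfold IsOrderPreserving
    rw [show card.map ((fibre S' i).map (Over.homMk σ : Over.mk (σ ≫ g) ⟶ Over.mk g)) = _ from
      this]
    exact monotone_eqToHom_iff _ _ _
  refine (forall_congr' key).trans ((SkFin.monotone_fibreMap_iff _).trans ?_)
  refine forall_congr' fun a => forall_congr' fun b => imp_congr_right fun _ => ?_
  exact imp_congr_left (Iff.of_eq (congrArg₂ (· = ·) (card_map_comp_apply σ g a)
    (card_map_comp_apply σ g b)))

lemma IsChosenLocalTerminal.fibre_obj {B : O} (hB : IsChosenLocalTerminal B) {A : O} (m : A ⟶ B)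
    (j) : (fibre B j).obj (Over.mk m) = A := by
  obtain ⟨c, rfl⟩ := hB
  rw [fibre_lt]
  rfl

lemma IsChosenLocalTerminal.card_obj {B : O} (hB : IsChosenLocalTerminal B) :
    card.obj B = ⟨1⟩ := by
  obtain ⟨c, rfl⟩ := hB
  exact card_lt c

lemma isQuasibijection_id (X : O) : IsQuasibijection (𝟙 X) := fun i => fibre_id X i

lemma IsQuasibijection.comp {T S R : O} {f : T ⟶ S} {g : S ⟶ R} (hf : IsQuasibijection f)
    (hg : IsQuasibijection g) : IsQuasibijection (f ≫ g) := by
  intro i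
  have hB := hg i
  have h1 : (card.obj ((fibre R i).obj (Over.mk g))).len = 1 := by rw [hB.card_obj]
  have j : Fin (card.obj ((fibre R i).obj (Over.mk g))).len := Fin.cast h1.symm 0
  have h := Functor.congr_obj (fibre_fibre (Over.mk g) i j) (Over.mk f)
  have h' := hB.fibre_obj
    ((fibre R i).map (Over.homMk f : Over.mk (f ≫ g) ⟶ Over.mk g)) j
  have h'' : (fibre R i).obj (Over.mk (f ≫ g)) = _ := h'.symm.trans h
  rw [h'']
  exact hf _

lemma IsQuasibijection.bijective {T S : O} {σ : T ⟶ S} (h : IsQuasibijection σ) :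
    Function.Bijective (card.map σ : Fin (card.obj T).len → Fin (card.obj S).len) := by
  rw [Function.bijective_iff_existsUnique]
  intro i
  have h1 := (Functor.congr_obj (fibre_card S i) (Over.mk σ)).symm.trans (h i).card_obj
  have h2 : (SkFin.preimage (card.map σ) i).card = 1 := congrArg SkFin.len h1
  obtain ⟨a, ha⟩ := Finset.card_eq_one.1 h2
  have hmem : ∀ b, card.map σ b = i ↔ b = a := fun b => by
    rw [← SkFin.mem_preimage, ha, Finset.mem_singleton]
  exact ⟨a, (hmem a).2 rfl, fun b hb => (hmem b).1 hb⟩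

lemma IsOrderPreserving.comp {T S R : O} {f : T ⟶ S} {g : S ⟶ R} (hf : IsOrderPreserving f)
    (hg : IsOrderPreserving g) : IsOrderPreserving (f ≫ g) := by
  intro a b hab
  rw [card_map_comp_apply, card_map_comp_apply]
  exact hg (hf hab)

lemma isOrderPreserving_id (T : O) : IsOrderPreserving (𝟙 T) := by
  intro a b hab
  rwa [card_map_id_apply, card_map_id_apply]

lemma fibrewiseOrderPreserving_of_isOrderPreserving {T T' S' : O} {σ : T ⟶ T'}
    (h : IsOrderPreserving σ) (g : T' ⟶ S') : FibrewiseOrderPreserving σ g :=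
  (fibrewiseOrderPreserving_iff σ g).2 fun _ _ hab _ => h hab

/-- Being fibrewise order-preserving over `R` implies being so over `S` when `S` maps to `R`. -/
lemma FibrewiseOrderPreserving.of_comp {T T' S R : O} {σ : T ⟶ T'} {a : T' ⟶ S} {b : S ⟶ R}
    (h : FibrewiseOrderPreserving σ (a ≫ b)) : FibrewiseOrderPreserving σ a := by
  rw [fibrewiseOrderPreserving_iff] at h ⊢
  intro x y hxy e
  refine h x y hxy ?_
  rw [card_map_comp_apply, card_map_comp_apply, e]

/-- Horizontal composition of fibrewise order-preserving squares. -/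
lemma FibrewiseOrderPreserving.comp {T T' T'' S' S'' : O} {σ : T ⟶ T'} {b : T' ⟶ S'}
    {ω : T' ⟶ T''} {c : T'' ⟶ S''} {l : S' ⟶ S''} (h : FibrewiseOrderPreserving σ b)
    (h' : FibrewiseOrderPreserving ω c) (hl : IsQuasibijection l) (w : b ≫ l = ω ≫ c) :
    FibrewiseOrderPreserving (σ ≫ ω) c := by
  rw [fibrewiseOrderPreserving_iff] at h h' ⊢
  intro x y hxy e
  rw [card_map_comp_apply, card_map_comp_apply] at e ⊢
  have hw : ∀ z, card.map l (card.map b z) = card.map c (card.map ω z) := fun z =>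
    (card_map_comp_apply b l z).symm.trans
      ((congrArg (fun m => card.map m z) w).trans (card_map_comp_apply ω c z))
  exact h' _ _ (h x y hxy (hl.bijective.1 ((hw _).trans (e.trans (hw _).symm)))) e

/-! ### Strictly factorisable operadic categories -/

/-- A pita factorisation of `f`: a quasibijection followed by an order-preserving morphism. -/
structure PitaFactorisation {T R : O} (f : T ⟶ R) where
  /-- The middle object. -/
  mid : O
  /-- The quasibijection. -/
  π : T ⟶ mid
  /-- The order-preserving morphism. -/
  η : mid ⟶ R
  fac : π ≫ η = f
  isQuasibijection : IsQuasibijection π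
  isOrderPreserving : IsOrderPreserving η

/-- The triangle of the pita factorisation is fibrewise order-preserving. -/
def PitaFactorisation.Fibrewise {T R : O} {f : T ⟶ R} (p : PitaFactorisation f) : Prop :=
  FibrewiseOrderPreserving p.π p.η

variable (O) in
/-- An operadic category is strictly factorisable if it is strongly factorisable (each morphism
has a unique fibrewise order-preserving pita factorisation) and, for each composable pair
`f : T ⟶ S`, `g : S ⟶ R`, there is a unique morphism `η(f/g)` between the middle objects of the
factorisations of `f ≫ g` and `g` that is compatible with `f` and with the identity of `R`. -/
class StrictlyFactorisable : Prop where
  existsUnique_pita {T R : O} (f : T ⟶ R) : ∃! p : PitaFactorisation f, p.Fibrewise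
  existsUnique_lift {T S R : O} (f : T ⟶ S) (g : S ⟶ R) (p : PitaFactorisation (f ≫ g))
    (q : PitaFactorisation g) (hp : p.Fibrewise) (hq : q.Fibrewise) :
    ∃! e : p.mid ⟶ q.mid, p.π ≫ e = f ≫ q.π ∧ e ≫ q.η = p.η

/-- The factorisation of an order-preserving morphism as an identity followed by itself. -/
def PitaFactorisation.ofOrd {T R : O} (f : T ⟶ R) (hf : IsOrderPreserving f) :
    PitaFactorisation f where
  mid := T
  π := 𝟙 T
  η := f
  fac := Category.id_comp f
  isQuasibijection := isQuasibijection_id T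
  isOrderPreserving := hf

lemma PitaFactorisation.ofOrd_fibrewise {T R : O} (f : T ⟶ R) (hf : IsOrderPreserving f) :
    (ofOrd f hf).Fibrewise :=
  fibrewiseOrderPreserving_of_isOrderPreserving (isOrderPreserving_id T) f

/-! ### The categories of chains -/

open SimplexCategory Simplicial

variable (O) in
/-- Objects of the category `W(O)_n`: chains `T_n ⟶ ⋯ ⟶ T_0` of morphisms of `O`, where `T_{n-k}`
is the value at `k`, so that the last object `T_0` of the chain is the value at `Fin.last n`. -/
structure W (a : SimplexCategory) where
  /-- The chain, as a functor. -/
  chain : Fin (a.len + 1) ⥤ O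

/-- The unique morphism to the last element. -/
def toLast {n : ℕ} (k : Fin (n + 1)) : k ⟶ Fin.last n := homOfLE (Fin.le_last k)

/-- Morphisms of `W(O)_n`: commutative ladders of quasibijections, all of which are fibrewise
order-preserving with respect to the last one. -/
@[ext]
structure W.Hom {a : SimplexCategory} (X Y : W O a) where
  /-- The ladder. -/
  app : X.chain ⟶ Y.chain
  isQuasibijection (k : Fin (a.len + 1)) : IsQuasibijection (app.app k)
  fibrewise (k : Fin (a.len + 1)) :
    FibrewiseOrderPreserving (app.app k) (Y.chain.map (toLast k))

instance (a : SimplexCategory) : Category (W O a) where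
  Hom := W.Hom
  id X :=
    { app := 𝟙 X.chain
      isQuasibijection := fun _ => isQuasibijection_id _
      fibrewise := fun _ =>
        fibrewiseOrderPreserving_of_isOrderPreserving (isOrderPreserving_id _) _ }
  comp f g :=
    { app := f.app ≫ g.app
      isQuasibijection := fun k => (f.isQuasibijection k).comp (g.isQuasibijection k)
      fibrewise := fun k => (f.fibrewise k).comp (g.fibrewise k) (g.isQuasibijection _)
        (g.app.naturality _) }
  id_comp f := W.Hom.ext (Category.id_comp f.app)
  comp_id f := W.Hom.ext (Category.comp_id f.app)
  assoc f g h := W.Hom.ext (Category.assoc f.app g.app h.app)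

lemma W.hom_ext {a : SimplexCategory} {X Y : W O a} {f g : X ⟶ Y}
    (h : ∀ k, f.app.app k = g.app.app k) : f = g :=
  W.Hom.ext (NatTrans.ext (funext h))

lemma W.Hom.fibrewise' {a : SimplexCategory} {X Y : W O a} (f : X ⟶ Y)
    {k l : Fin (a.len + 1)} (h : k ⟶ l) :
    FibrewiseOrderPreserving (f.app.app k) (Y.chain.map h) := by
  have := f.fibrewise k
  rw [show toLast k = h ≫ toLast l from Subsingleton.elim _ _, Functor.map_comp] at this
  exact this.of_comp

/-- The simplicial operators of `W(O)`, by precomposition. In particular, the `i`-th face omits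
the `i`-th object of the chain, and the `i`-th degeneracy repeats it. -/
def W.map {a b : SimplexCategory} (α : a ⟶ b) : W O b ⥤ W O a where
  obj X := ⟨α.toOrderHom.monotone.functor ⋙ X.chain⟩
  map f :=
    { app := Functor.whiskerLeft _ f.app
      isQuasibijection := fun _ => f.isQuasibijection _
      fibrewise := fun _ => f.fibrewise' _ }

variable (O) in
lemma W.map_comp {a b c : SimplexCategory} (α : a ⟶ b) (β : b ⟶ c) :
    W.map (O := O) (α ≫ β) = W.map β ⋙ W.map α := rfl

variable (O) in
/-- Locally order-preserving chains: all composites `T_k ⟶ T_0` are order-preserving. -/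
def locallyOrderPreserving (a : SimplexCategory) : ObjectProperty (W O a) :=
  fun X => ∀ k, IsOrderPreserving (X.chain.map (toLast k))

variable (O) in
/-- The category `P(O)_n`: the full subcategory of `W(O)_n` on the locally order-preserving
chains. -/
abbrev P (a : SimplexCategory) := (locallyOrderPreserving O a).FullSubcategory

variable (O) in
/-- The inclusion `i_n` of `P(O)_n` in `W(O)_n`. -/
abbrev incl (a : SimplexCategory) : P O a ⥤ W O a := (locallyOrderPreserving O a).ι

variable (O) in
/-- A simplicial operator that preserves the last element restricts to locally order-preserving
chains. -/
def P.restrict {a b : SimplexCategory} (α : a ⟶ b)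
    (hα : α.toOrderHom (Fin.last a.len) = Fin.last b.len) : P O b ⥤ P O a :=
  (locallyOrderPreserving O a).lift (incl O b ⋙ W.map α) (by
    intro X k
    have h : ∀ (l : Fin (b.len + 1)) (m : α.toOrderHom k ⟶ l), l = Fin.last _ →
        IsOrderPreserving (X.obj.chain.map m) := by
      rintro _ m rfl
      exact X.property _
    exact h _ _ hα)

variable [StrictlyFactorisable O]

/-- The pita factorisation of `f`. -/
noncomputable def pita {T R : O} (f : T ⟶ R) : PitaFactorisation f :=
  (StrictlyFactorisable.existsUnique_pita f).choose

lemma pita_fibrewise {T R : O} (f : T ⟶ R) : (pita f).Fibrewise :=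
  (StrictlyFactorisable.existsUnique_pita f).choose_spec.1

lemma PitaFactorisation.Fibrewise.eq {T R : O} {f : T ⟶ R} {p q : PitaFactorisation f}
    (hp : p.Fibrewise) (hq : q.Fibrewise) : p = q :=
  (StrictlyFactorisable.existsUnique_pita f).unique hp hq

lemma existsUnique_etaLift {T S R : O} (f : T ⟶ S) (g : S ⟶ R) (h : T ⟶ R) (w : f ≫ g = h) :
    ∃! e : (pita h).mid ⟶ (pita g).mid,
      (pita h).π ≫ e = f ≫ (pita g).π ∧ e ≫ (pita g).η = (pita h).η := by
  subst w
  exact StrictlyFactorisable.existsUnique_lift f g _ _ (pita_fibrewise _) (pita_fibrewise _)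

/-- The morphism `η(f/g)`, for `h` the composite of `f : T ⟶ S` and `g : S ⟶ R`. -/
noncomputable def etaLift {T S R : O} (f : T ⟶ S) (g : S ⟶ R) (h : T ⟶ R) (w : f ≫ g = h) :
    (pita h).mid ⟶ (pita g).mid :=
  (existsUnique_etaLift f g h w).choose

lemma π_etaLift {T S R : O} (f : T ⟶ S) (g : S ⟶ R) (h : T ⟶ R) (w : f ≫ g = h) :
    (pita h).π ≫ etaLift f g h w = f ≫ (pita g).π :=
  (existsUnique_etaLift f g h w).choose_spec.1.1

lemma etaLift_η {T S R : O} (f : T ⟶ S) (g : S ⟶ R) (h : T ⟶ R) (w : f ≫ g = h) :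
    etaLift f g h w ≫ (pita g).η = (pita h).η :=
  (existsUnique_etaLift f g h w).choose_spec.1.2

lemma pita_hom_ext {T S' T'' : O} {h : T ⟶ S'} {p : PitaFactorisation h} (hp : p.Fibrewise)
    {g : T'' ⟶ S'} (hg : IsOrderPreserving g) {u : T ⟶ T''} {e e' : p.mid ⟶ T''}
    (h1 : p.π ≫ e = u) (h1' : p.π ≫ e' = u) (h2 : e ≫ g = p.η) (h2' : e' ≫ g = p.η) :
    e = e' := by
  have w : u ≫ g = h := by rw [← h1, Category.assoc, h2, p.fac]
  subst w
  refine (StrictlyFactorisable.existsUnique_lift u g p (.ofOrd g hg) hp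
    (PitaFactorisation.ofOrd_fibrewise g hg)).unique ⟨?_, h2⟩ ⟨?_, h2'⟩
  · exact h1.trans (Category.comp_id u).symm
  · exact h1'.trans (Category.comp_id u).symm

/-- The pasting of the pita factorisations of `f` and of `η(f) ≫ τ`, for `τ` a quasibijection. -/
noncomputable def pastedPita {T S S' : O} (f : T ⟶ S) {τ : S ⟶ S'} :
    PitaFactorisation (f ≫ τ) where
  mid := (pita ((pita f).η ≫ τ)).mid
  π := (pita f).π ≫ (pita ((pita f).η ≫ τ)).π
  η := (pita ((pita f).η ≫ τ)).η
  fac := by rw [Category.assoc, PitaFactorisation.fac, ← Category.assoc, PitaFactorisation.fac]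
  isQuasibijection := (pita f).isQuasibijection.comp (pita _).isQuasibijection
  isOrderPreserving := (pita _).isOrderPreserving

lemma pastedPita_fibrewise {T S S' : O} (f : T ⟶ S) {τ : S ⟶ S'} (hτ : IsQuasibijection τ) :
    (pastedPita f (τ := τ)).Fibrewise :=
  FibrewiseOrderPreserving.comp (pita_fibrewise f) (pita_fibrewise _) hτ
    (PitaFactorisation.fac _).symm

lemma omega_ext {T S S' T'' : O} (f : T ⟶ S) {τ : S ⟶ S'} (hτ : IsQuasibijection τ)
    {g : T'' ⟶ S'} (hg : IsOrderPreserving g) {ω ω' : (pita f).mid ⟶ T''}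
    (h : (pita f).π ≫ ω = (pita f).π ≫ ω') (h1 : ω ≫ g = (pita f).η ≫ τ)
    (h1' : ω' ≫ g = (pita f).η ≫ τ) : ω = ω' := by
  have key : ∀ ω : (pita f).mid ⟶ T'', ω ≫ g = (pita f).η ≫ τ →
      ∃ α, (pita ((pita f).η ≫ τ)).π ≫ α = ω ∧ α ≫ g = (pita ((pita f).η ≫ τ)).η := by
    intro ω hω
    rw [← hω]
    obtain ⟨α, ⟨h1, h2⟩, -⟩ := StrictlyFactorisable.existsUnique_lift ω g (pita (ω ≫ g))
      (.ofOrd g hg) (pita_fibrewise _) (PitaFactorisation.ofOrd_fibrewise g hg)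
    exact ⟨α, h1.trans (Category.comp_id ω), h2⟩
  obtain ⟨α, ha, ha'⟩ := key ω h1
  obtain ⟨α', hb, hb'⟩ := key ω' h1'
  have : α = α' := pita_hom_ext (p := pastedPita f (τ := τ)) (pastedPita_fibrewise f hτ) hg
    (u := (pita f).π ≫ ω) ((Category.assoc _ _ _).trans (congrArg _ ha))
    ((Category.assoc _ _ _).trans ((congrArg _ hb).trans h.symm)) ha' hb'
  rw [← ha, ← hb, this]

/-- A fibrewise order-preserving square with horizontal quasibijections induces a morphism between
the order-preserving parts of its vertical sides. -/
lemma exists_omega {T S T' S' : O} {f : T ⟶ S} {g : T' ⟶ S'} {σ : T ⟶ T'} {τ : S ⟶ S'}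
    (hσ : IsQuasibijection σ) (hτ : IsQuasibijection τ) (h : FibrewiseOrderPreserving σ g)
    (w : f ≫ τ = σ ≫ g) :
    ∃ ω : (pita f).mid ⟶ (pita g).mid, IsQuasibijection ω ∧
      FibrewiseOrderPreserving ω (pita g).η ∧ (pita f).π ≫ ω = σ ≫ (pita g).π ∧
      ω ≫ (pita g).η = (pita f).η ≫ τ := by
  let q : PitaFactorisation (f ≫ τ) :=
    { mid := (pita g).mid
      π := σ ≫ (pita g).π
      η := (pita g).η
      fac := by rw [Category.assoc, PitaFactorisation.fac, w]
      isQuasibijection := hσ.comp (pita g).isQuasibijection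
      isOrderPreserving := (pita g).isOrderPreserving }
  have hq : q.Fibrewise := FibrewiseOrderPreserving.comp h (pita_fibrewise g)
    (isQuasibijection_id _) ((Category.comp_id _).trans (pita g).fac.symm)
  have e := (pastedPita_fibrewise f hτ).eq hq
  have : ∀ q : PitaFactorisation (f ≫ τ), pastedPita f = q →
      ∃ ω : (pita f).mid ⟶ q.mid, IsQuasibijection ω ∧
      FibrewiseOrderPreserving ω q.η ∧ (pita f).π ≫ ω = q.π ∧ ω ≫ q.η = (pita f).η ≫ τ := by
    rintro _ rfl
    exact ⟨(pita ((pita f).η ≫ τ)).π, (pita _).isQuasibijection, pita_fibrewise _, rfl,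
      (pita _).fac⟩
  exact this q e

/-! ### The reflections -/

/-- The chain `T'_n ⟶ ⋯ ⟶ T'_0` of the morphisms `η(f_k / f_1 ⋯ f_{k-1})`. -/
noncomputable def reflChain {a : SimplexCategory} (X : W O a) : Fin (a.len + 1) ⥤ O where
  obj k := (pita (X.chain.map (toLast k))).mid
  map {k l} m := etaLift (X.chain.map m) (X.chain.map (toLast l)) (X.chain.map (toLast k))
    (by rw [← Functor.map_comp]; rfl)
  map_id k := by
    refine (existsUnique_etaLift (X.chain.map (𝟙 k)) (X.chain.map (toLast k)) _
      (by rw [← Functor.map_comp]; rfl)).unique ⟨π_etaLift _ _ _ _, etaLift_η _ _ _ _⟩ ⟨?_, ?_⟩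
    · simp
    · simp
  map_comp {k l m} f g := by
    refine (existsUnique_etaLift (X.chain.map (f ≫ g)) (X.chain.map (toLast m)) _
      (by rw [← Functor.map_comp]; rfl)).unique ⟨π_etaLift _ _ _ _, etaLift_η _ _ _ _⟩ ⟨?_, ?_⟩
    · rw [← Category.assoc, π_etaLift, Category.assoc, π_etaLift, Functor.map_comp,
        Category.assoc]
    · rw [Category.assoc, etaLift_η, etaLift_η]

lemma pita_id_η_strictMono (T : O) : StrictMono
    (card.map (pita (𝟙 T)).η : Fin (card.obj (pita (𝟙 T)).mid).len → Fin (card.obj T).len) := by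
  have h : ∀ p : PitaFactorisation (𝟙 T), p = .ofOrd (𝟙 T) (isOrderPreserving_id T) →
      StrictMono (card.map p.η : Fin (card.obj p.mid).len → Fin (card.obj T).len) := by
    rintro _ rfl a b hab
    exact (card_map_id_apply a).trans_lt (hab.trans_eq (card_map_id_apply b).symm)
  exact h _ ((pita_fibrewise _).eq (PitaFactorisation.ofOrd_fibrewise _ _))

lemma pita_η_strictMono {T : O} (f : T ⟶ T) (hf : f = 𝟙 T) : StrictMono
    (card.map (pita f).η : Fin (card.obj (pita f).mid).len → Fin (card.obj T).len) := by
  subst hf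
  exact pita_id_η_strictMono T

lemma reflChain_locallyOrderPreserving {a : SimplexCategory} (X : W O a) :
    locallyOrderPreserving O a ⟨reflChain X⟩ := by
  intro k x y hxy
  have hm := pita_η_strictMono (X.chain.map (toLast (Fin.last a.len))) (X.chain.map_id _)
  have h := etaLift_η (X.chain.map (toLast k)) (X.chain.map (toLast (Fin.last a.len)))
    (X.chain.map (toLast k)) (X.chain.map_comp _ _).symm
  have h' : ∀ z, card.map (pita (X.chain.map (toLast (Fin.last a.len)))).η (card.map
      (etaLift (X.chain.map (toLast k)) (X.chain.map (toLast (Fin.last a.len)))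
        (X.chain.map (toLast k)) (X.chain.map_comp _ _).symm) z) =
      card.map (pita (X.chain.map (toLast k))).η z := fun z =>
    (card_map_comp_apply _ _ z).symm.trans (congrArg (fun m => card.map m z) h)
  exact hm.le_iff_le.1 (((h' x).trans_le ((pita _).isOrderPreserving hxy)).trans_eq (h' y).symm)

lemma exists_reflMap {a : SimplexCategory} {X Y : W O a} (f : X ⟶ Y) (k : Fin (a.len + 1)) :
    ∃ ω : (pita (X.chain.map (toLast k))).mid ⟶ (pita (Y.chain.map (toLast k))).mid,
      IsQuasibijection ω ∧ FibrewiseOrderPreserving ω (pita (Y.chain.map (toLast k))).η ∧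
      (pita (X.chain.map (toLast k))).π ≫ ω = f.app.app k ≫ (pita (Y.chain.map (toLast k))).π ∧
      ω ≫ (pita (Y.chain.map (toLast k))).η =
        (pita (X.chain.map (toLast k))).η ≫ f.app.app (Fin.last a.len) :=
  exists_omega (f.isQuasibijection k) (f.isQuasibijection _) (f.fibrewise k)
    (f.app.naturality _)

/-- The components `ω` of the reflection of a morphism of `W(O)_n`: the morphisms making the
prisms between `f` and its reflection commute. -/
noncomputable def reflApp {a : SimplexCategory} {X Y : W O a} (f : X ⟶ Y)
    (k : Fin (a.len + 1)) :
    (pita (X.chain.map (toLast k))).mid ⟶ (pita (Y.chain.map (toLast k))).mid :=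
  (exists_reflMap f k).choose

lemma reflApp_isQuasibijection {a : SimplexCategory} {X Y : W O a} (f : X ⟶ Y)
    (k : Fin (a.len + 1)) : IsQuasibijection (reflApp f k) :=
  (exists_reflMap f k).choose_spec.1

lemma reflApp_fibrewise {a : SimplexCategory} {X Y : W O a} (f : X ⟶ Y)
    (k : Fin (a.len + 1)) :
    FibrewiseOrderPreserving (reflApp f k) (pita (Y.chain.map (toLast k))).η :=
  (exists_reflMap f k).choose_spec.2.1

lemma π_reflApp {a : SimplexCategory} {X Y : W O a} (f : X ⟶ Y) (k : Fin (a.len + 1)) :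
    (pita (X.chain.map (toLast k))).π ≫ reflApp f k =
      f.app.app k ≫ (pita (Y.chain.map (toLast k))).π :=
  (exists_reflMap f k).choose_spec.2.2.1

lemma reflApp_η {a : SimplexCategory} {X Y : W O a} (f : X ⟶ Y) (k : Fin (a.len + 1)) :
    reflApp f k ≫ (pita (Y.chain.map (toLast k))).η =
        (pita (X.chain.map (toLast k))).η ≫ f.app.app (Fin.last a.len) :=
  (exists_reflMap f k).choose_spec.2.2.2

lemma reflApp_naturality {a : SimplexCategory} {X Y : W O a} (f : X ⟶ Y)
    {k l : Fin (a.len + 1)} (m : k ⟶ l) :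
    etaLift (X.chain.map m) (X.chain.map (toLast l)) (X.chain.map (toLast k))
        (X.chain.map_comp m (toLast l)).symm ≫ reflApp f l =
      reflApp f k ≫ etaLift (Y.chain.map m) (Y.chain.map (toLast l)) (Y.chain.map (toLast k))
        (Y.chain.map_comp m (toLast l)).symm := by
  refine omega_ext (X.chain.map (toLast k)) (f.isQuasibijection (Fin.last _))
    (pita (Y.chain.map (toLast l))).isOrderPreserving ?_ ?_ ?_
  · rw [← Category.assoc, π_etaLift, Category.assoc, π_reflApp,
      ← Category.assoc (pita (X.chain.map (toLast k))).π, π_reflApp, Category.assoc, π_etaLift,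
      f.app.naturality_assoc]
  · rw [Category.assoc, reflApp_η, ← Category.assoc, etaLift_η]
  · rw [Category.assoc, etaLift_η, reflApp_η]

lemma reflApp_id {a : SimplexCategory} (X : W O a) (k : Fin (a.len + 1)) :
    reflApp (𝟙 X) k = 𝟙 _ := by
  refine omega_ext (X.chain.map (toLast k)) (isQuasibijection_id _)
    (pita (X.chain.map (toLast k))).isOrderPreserving ?_ (reflApp_η (𝟙 X) k) ?_
  · refine (π_reflApp (𝟙 X) k).trans ?_
    exact (Category.id_comp _).trans (Category.comp_id _).symm
  · exact (Category.id_comp _).trans (Category.comp_id _).symm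

lemma reflApp_comp {a : SimplexCategory} {X Y Z : W O a} (f : X ⟶ Y) (g : Y ⟶ Z)
    (k : Fin (a.len + 1)) : reflApp (f ≫ g) k = reflApp f k ≫ reflApp g k := by
  refine omega_ext (X.chain.map (toLast k)) ((f ≫ g).isQuasibijection (Fin.last _))
    (pita (Z.chain.map (toLast k))).isOrderPreserving ?_ (reflApp_η (f ≫ g) k) ?_
  · refine (π_reflApp (f ≫ g) k).trans ?_
    rw [← Category.assoc, π_reflApp, Category.assoc, π_reflApp]
    exact Category.assoc _ _ _
  · rw [Category.assoc, reflApp_η, ← Category.assoc, reflApp_η]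
    exact Category.assoc _ _ _

/-- The reflection of a morphism of `W(O)_n`. -/
noncomputable def reflMap {a : SimplexCategory} {X Y : W O a} (f : X ⟶ Y) :
    (⟨reflChain X⟩ : W O a) ⟶ ⟨reflChain Y⟩ :=
  W.Hom.mk
    { app := reflApp f
      naturality := fun _ _ m => reflApp_naturality f m }
    (fun k => reflApp_isQuasibijection f k)
    (fun k => by
      have := reflApp_fibrewise f k
      rw [← etaLift_η (Y.chain.map (toLast k)) (Y.chain.map (toLast (Fin.last a.len)))
        (Y.chain.map (toLast k))
        (Y.chain.map_comp _ _).symm] at this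
      exact this.of_comp)

variable (O) in
/-- The reflection `r_n : W(O)_n ⥤ P(O)_n`. -/
noncomputable def refl (a : SimplexCategory) : W O a ⥤ P O a where
  obj X := ⟨⟨reflChain X⟩, reflChain_locallyOrderPreserving X⟩
  map f := ObjectProperty.homMk (reflMap f)
  map_id X := ObjectProperty.hom_ext _ (W.hom_ext fun k => reflApp_id X k)
  map_comp f g := ObjectProperty.hom_ext _ (W.hom_ext fun k => reflApp_comp f g k)

variable (O) in
/-- The unit `π_n` of the reflection, given by the quasibijections `π(f_1 ⋯ f_k)`. -/
noncomputable def unit (a : SimplexCategory) : 𝟭 (W O a) ⟶ refl O a ⋙ incl O a where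
  app X := W.Hom.mk
    { app := fun k => (pita (X.chain.map (toLast k))).π
      naturality := fun k l m => (π_etaLift (X.chain.map m) (X.chain.map (toLast l))
        (X.chain.map (toLast k)) (X.chain.map_comp m (toLast l)).symm).symm }
    (fun k => (pita (X.chain.map (toLast k))).isQuasibijection)
    (fun k => by
      have := pita_fibrewise (X.chain.map (toLast k))
      unfold PitaFactorisation.Fibrewise at this
      rw [← etaLift_η (X.chain.map (toLast k)) (X.chain.map (toLast (Fin.last a.len)))
        (X.chain.map (toLast k))
        (X.chain.map_comp _ _).symm] at this
      exact this.of_comp)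
  naturality X Y f := W.hom_ext fun k => (π_reflApp f k).symm

/-! ### The pita nerve -/

lemma δ_castSucc_last {n : ℕ} (i : Fin (n + 1)) :
    (δ (i.castSucc : Fin (n + 2))).toOrderHom (Fin.last _) = Fin.last _ :=
  Fin.succAbove_of_le_castSucc _ _ (Fin.castSucc_le_castSucc_iff.2 (Fin.le_last i))

lemma σ_last {n : ℕ} (i : Fin (n + 1)) :
    (σ i).toOrderHom (Fin.last _) = Fin.last _ :=
  Fin.predAbove_right_last

variable (O) in
/-- The face operators `d_i : P(O)_{n+1} ⥤ P(O)_n`, for `i ≤ n`. -/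
def face (n : ℕ) (i : Fin (n + 1)) : P O ⦋n + 1⦌ ⥤ P O ⦋n⦌ :=
  P.restrict O (δ i.castSucc) (δ_castSucc_last i)

variable (O) in
/-- The degeneracy operators `s_i : P(O)_n ⥤ P(O)_{n+1}`. -/
def degeneracy (n : ℕ) (i : Fin (n + 1)) : P O ⦋n⦌ ⥤ P O ⦋n + 1⦌ :=
  P.restrict O (σ i) (σ_last i)

variable (O) in
/-- The top face operator `d_{n+1} : P(O)_{n+1} ⥤ P(O)_n`: include in `W(O)_{n+1}`, omit the last
object, and reflect back. -/
noncomputable def topFace (n : ℕ) : P O ⦋n + 1⦌ ⥤ P O ⦋n⦌ :=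
  incl O ⦋n + 1⦌ ⋙ W.map (δ (Fin.last (n + 1))) ⋙ refl O ⦋n⦌

variable (O) in
lemma face_comp_topFace (n : ℕ) : face O (n + 1) (Fin.last (n + 1)) ⋙ topFace O n =
    (incl O ⦋n + 2⦌ ⋙ W.map (δ (Fin.last (n + 2)))) ⋙ 𝟭 (W O ⦋n + 1⦌) ⋙
      W.map (δ (Fin.last (n + 1))) ⋙ refl O ⦋n⦌ := by
  have h := congrArg (fun α => incl O ⦋n + 2⦌ ⋙ W.map (O := O) α ⋙ refl O ⦋n⦌)
    (δ_comp_δ_self (i := Fin.last (n + 1)))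
  exact h

variable (O) in
/-- The `2`-cell `β_n : d_{n+1} d_{n+1} ⟶ d_{n+1} d_{n+2}` (composites of operators), obtained
from the unit of the reflection on `W(O)_{n+1}`. -/
noncomputable def β (n : ℕ) :
    face O (n + 1) (Fin.last (n + 1)) ⋙ topFace O n ⟶ topFace O (n + 1) ⋙ topFace O n :=
  eqToHom (face_comp_topFace O n) ≫
    Functor.whiskerLeft (incl O ⦋n + 2⦌ ⋙ W.map (δ (Fin.last (n + 2))))
      (Functor.whiskerRight (unit O ⦋n + 1⦌) (W.map (δ (Fin.last (n + 1))) ⋙ refl O ⦋n⦌))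

/-! ### Pseudo-simplicial groupoids -/

/-- The `2`-category of groupoids: the full sub-`2`-category of the `2`-category of categories on
the groupoids. -/
abbrev Gpd :=
  Bicategory.InducedBicategory Cat.{v, w} (Subtype.val : {C : Cat.{v, w} // IsGroupoid C} → Cat)

/-- The data of a pseudofunctor with given values `X_a` on the objects of the opposite of the
simplex category, see `PseudoSimplicial.toPseudofunctor`. -/
structure PseudoSimplicial (X : SimplexCategory → Type w) [∀ a, Category.{v} (X a)] where
  /-- The functor attached to a simplicial operator. -/
  map {a b : SimplexCategory} (α : a ⟶ b) : X b ⥤ X a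
  /-- The unit constraint. -/
  mapId (a : SimplexCategory) : map (𝟙 a) ≅ 𝟭 (X a)
  /-- The composition constraint. -/
  mapComp {a b c : SimplexCategory} (α : a ⟶ b) (γ : b ⟶ c) : map (α ≫ γ) ≅ map γ ⋙ map α
  map_assoc {a b c d : SimplexCategory} (α : a ⟶ b) (γ : b ⟶ c) (κ : c ⟶ d) (x : X d) :
    (mapComp (α ≫ γ) κ).hom.app x ≫ (mapComp α γ).hom.app ((map κ).obj x) =
      eqToHom (by rw [Category.assoc]) ≫ (mapComp α (γ ≫ κ)).hom.app x ≫
        (map α).map ((mapComp γ κ).hom.app x)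
  map_id_comp {a b : SimplexCategory} (α : a ⟶ b) (x : X b) :
    (mapComp (𝟙 a) α).hom.app x ≫ (mapId a).hom.app ((map α).obj x) =
      eqToHom (by rw [Category.id_comp]; rfl)
  map_comp_id {a b : SimplexCategory} (α : a ⟶ b) (x : X b) :
    (mapComp α (𝟙 b)).hom.app x ≫ (map α).map ((mapId b).hom.app x) =
      eqToHom (by rw [Category.comp_id]; rfl)

namespace PseudoSimplicial

variable {X : SimplexCategory → Type w} [∀ a, Category.{v} (X a)]

lemma map_assoc_inv (S : PseudoSimplicial X) {a b c d : SimplexCategory} (α : a ⟶ b)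
    (γ : b ⟶ c) (κ : c ⟶ d) (x : X d) :
    (S.mapComp α (γ ≫ κ)).hom.app x ≫ (S.map α).map ((S.mapComp γ κ).hom.app x) ≫
      (S.mapComp α γ).inv.app ((S.map κ).obj x) ≫ (S.mapComp (α ≫ γ) κ).inv.app x =
      eqToHom (by rw [Category.assoc]) := by
  rw [← cancel_epi (eqToHom (by rw [Category.assoc]) :
    (S.map ((α ≫ γ) ≫ κ)).obj x ⟶ (S.map (α ≫ γ ≫ κ)).obj x)]
  have e := congrArg (fun m => m ≫ (S.mapComp α γ).inv.app ((S.map κ).obj x) ≫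
    (S.mapComp (α ≫ γ) κ).inv.app x) (S.map_assoc α γ κ x)
  simp only [Category.assoc, Iso.hom_inv_id_app_assoc] at e
  rw [← e, Iso.hom_inv_id_app, eqToHom_trans, eqToHom_refl]

/-- The pseudofunctor from the opposite of the simplex category to categories. -/
def toCat (S : PseudoSimplicial X) :
    Pseudofunctor (LocallyDiscrete SimplexCategoryᵒᵖ) Cat.{v, w} :=
  pseudofunctorOfIsLocallyDiscrete
    (fun a => Cat.of (X a.as.unop))
    (fun f => (S.map f.as.unop).toCatHom)
    (fun a => Cat.Hom.isoMk (S.mapId a.as.unop))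
    (fun f g => Cat.Hom.isoMk (S.mapComp g.as.unop f.as.unop))
    (fun f g h => by
      ext x
      refine Eq.trans ?_ (Cat.eqToHom_app _ _ _ _).symm
      refine Eq.trans ?_ (S.map_assoc_inv h.as.unop g.as.unop f.as.unop x)
      exact congrArg (fun m => (S.mapComp h.as.unop (g.as.unop ≫ f.as.unop)).hom.app x ≫
        (S.map h.as.unop).map ((S.mapComp g.as.unop f.as.unop).hom.app x) ≫ m)
        (Category.id_comp _))
    (fun f => by
      ext x
      refine Eq.trans ?_ (Cat.eqToHom_app _ _ _ _).symm
      refine Eq.trans ?_ (S.map_comp_id f.as.unop x)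
      exact (Category.assoc _ _ _).symm.trans (Category.comp_id _))
    (fun f => by
      ext x
      refine Eq.trans ?_ (Cat.eqToHom_app _ _ _ _).symm
      refine Eq.trans ?_ (S.map_id_comp f.as.unop x)
      exact (Category.assoc _ _ _).symm.trans (Category.comp_id _))

/-- The pseudofunctor from the opposite of the simplex category to groupoids. -/
def toPseudofunctor (S : PseudoSimplicial X) (h : ∀ a, IsGroupoid (X a)) :
    Pseudofunctor (LocallyDiscrete SimplexCategoryᵒᵖ) Gpd.{v, w} :=
  pseudofunctorOfIsLocallyDiscrete
    (fun a => ⟨Cat.of (X a.as.unop), h a.as.unop⟩)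
    (fun f => Bicategory.InducedBicategory.mkHom (S.toCat.map f))
    (fun a => Bicategory.InducedBicategory.isoMk (S.toCat.mapId a))
    (fun f g => Bicategory.InducedBicategory.isoMk (S.toCat.mapComp f g))
    (fun f g h => by
      apply Bicategory.InducedBicategory.hom₂_ext
      refine Eq.trans ?_ (Bicategory.InducedBicategory.eqToHom_hom _).symm
      exact (S.toCat.map₂_associator f g h).symm)
    (fun f => by
      apply Bicategory.InducedBicategory.hom₂_ext
      refine Eq.trans ?_ (Bicategory.InducedBicategory.eqToHom_hom _).symm
      exact (S.toCat.map₂_left_unitor f).symm)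
    (fun f => by
      apply Bicategory.InducedBicategory.hom₂_ext
      refine Eq.trans ?_ (Bicategory.InducedBicategory.eqToHom_hom _).symm
      exact (S.toCat.map₂_right_unitor f).symm)

end PseudoSimplicial
namespace PseudoSimplicial

variable {X : SimplexCategory → Type w} [∀ a, Category.{v} (X a)]

/-- The `2`-cell of a pseudofunctor attached to a commutative square of simplicial operators. -/
def square (S : PseudoSimplicial X) {a b b' c : SimplexCategory} {α : a ⟶ b} {γ : b ⟶ c}
    {α' : a ⟶ b'} {γ' : b' ⟶ c} (h : α ≫ γ = α' ≫ γ') :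
    S.map γ ⋙ S.map α ≅ S.map γ' ⋙ S.map α' :=
  (S.mapComp α γ).symm ≪≫ eqToIso (congrArg S.map h) ≪≫ S.mapComp α' γ'

/-- The `2`-cell of a pseudofunctor attached to a section of a simplicial operator. -/
def triangle (S : PseudoSimplicial X) {a b : SimplexCategory} {α : a ⟶ b} {γ : b ⟶ a}
    (h : α ≫ γ = 𝟙 a) : 𝟭 (X a) ≅ S.map γ ⋙ S.map α :=
  (S.mapId a).symm ≪≫ eqToIso (congrArg S.map h.symm) ≪≫ S.mapComp α γ

end PseudoSimplicial

/-- A natural transformation is an identity: its source and target are equal functors, and it is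
the identity modulo this equality. -/
def IsIdentity {C : Type*} [Category* C] {D : Type*} [Category* D] {F G : C ⥤ D} (t : F ⟶ G) :
    Prop :=
  ∃ h : F = G, t = eqToHom h

/-- The pseudo-simplicial object `S` with values `P(O)_n` extends the pre-simplicial data of the
pita nerve: it has its face and degeneracy operators, the `2`-cells attached by `S` to pairs of
consecutive top face operators are the cells `β_n`, and those attached to all other simplicial
identities are identities. -/
structure PseudoSimplicial.IsPitaNerve (S : PseudoSimplicial (P O)) : Prop where
  map_face (n : ℕ) (i : Fin (n + 1)) : S.map (δ i.castSucc) = face O n i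
  map_topFace (n : ℕ) : S.map (δ (Fin.last (n + 1))) = topFace O n
  map_degeneracy (n : ℕ) (i : Fin (n + 1)) : S.map (σ i) = degeneracy O n i
  /-- The cell `d_{n+1} d_{n+1} ⟶ d_{n+1} d_{n+2}` on `P(O)_{n+2}` is `β_n`. -/
  square_top (n : ℕ) :
    (S.square (δ_comp_δ_self (i := Fin.last (n + 1)))).hom =
      eqToHom (congrArg₂ (· ⋙ ·) (map_face (n + 1) (Fin.last (n + 1))) (map_topFace n)) ≫
        β O n ≫
        eqToHom (congrArg₂ (· ⋙ ·) (map_topFace (n + 1)) (map_topFace n)).symm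
  /-- `d_j d_i ⟶ d_i d_{j+1}` for `i ≤ j`, not both top faces. -/
  square_face_face (n : ℕ) (i j : Fin (n + 2)) (h : i ≤ j) (hi : i ≠ Fin.last (n + 1)) :
    IsIdentity (S.square (δ_comp_δ h).symm).hom
  /-- `d_i s_{j+1} ⟶ s_j d_i` for `i ≤ j`. -/
  square_face_degeneracy_of_le (n : ℕ) (i : Fin (n + 2)) (j : Fin (n + 1))
    (h : i ≤ j.castSucc) : IsIdentity (S.square (δ_comp_σ_of_le h)).hom
  /-- `d_{i+1} s_j ⟶ s_j d_i` for `i > j`. -/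
  square_face_degeneracy_of_gt (n : ℕ) (i : Fin (n + 2)) (j : Fin (n + 1))
    (h : j.castSucc < i) : IsIdentity (S.square (δ_comp_σ_of_gt h)).hom
  /-- `1 ⟶ d_i s_i`. -/
  triangle_castSucc (n : ℕ) (i : Fin (n + 1)) :
    IsIdentity (S.triangle (δ_comp_σ_self (i := i))).hom
  /-- `1 ⟶ d_{i+1} s_i`. -/
  triangle_succ (n : ℕ) (i : Fin (n + 1)) :
    IsIdentity (S.triangle (δ_comp_σ_succ (i := i))).hom
  /-- `s_i s_j ⟶ s_{j+1} s_i` for `i ≤ j`. -/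
  square_degeneracy_degeneracy (n : ℕ) (i j : Fin (n + 1)) (h : i ≤ j) :
    IsIdentity (S.square (σ_comp_σ h)).hom

end PitaNerve

namespace PitaNerve

open OperadicCategory SimplexCategory Simplicial

/-! ### Morphisms that are identities up to an equality of objects -/

/-! The chains `W(O)` form a strict simplicial object, since its operators act by precomposition
(`W.map_comp` is definitional). The nerve carries this structure over to `P(O)` along the
reflection: an operator `α` acts by including a chain in `W(O)`, applying `W.map α` and reflecting
back. The composition constraint is the unit of the reflection inserted between two operators. It is
invertible because the unit consists of quasibijections and `W(O)` is a groupoid (`W.isGroupoid`).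
Its associativity is the naturality square of the unit (`pitaMapComp_assoc`).

The rest is strictness. An order-preserving morphism is its own order-preserving part, by uniqueness
of pita factorisations, so the unit is an identity on locally order-preserving chains and reflecting
such a chain changes nothing (`incl_comp_refl`). Hence an operator that preserves the last vertex
acts by plain restriction (`pitaNerve_map`), and the constraint for `α ≫ γ` is an identity as soon
as `α` or `γ` preserves the last vertex (`pitaMapComp_isEqToHom`). If `γ` does, the unit is taken at
a locally order-preserving chain. If `α` does, the reflection turns the restricted unit into an
identity (`refl_map_unit_isEqToHom`).

Among the generators only the top cofaces move the last vertex. So every simplicial identity has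
both of its constraints trivial, except the one between two top faces, where one constraint survives
and is the whiskered unit that defines `β`. -/

/-- The morphism `f` is the identity modulo an equality of its source and target. -/
def IsEqToHom {C : Type*} [Category* C] {X Y : C} (f : X ⟶ Y) : Prop :=
  ∃ h : X = Y, f = eqToHom h

namespace IsEqToHom

variable {C : Type*} [Category* C] {D : Type*} [Category* D]

lemma id (X : C) : IsEqToHom (𝟙 X) := ⟨rfl, rfl⟩

lemma comp {X Y Z : C} {f : X ⟶ Y} {g : Y ⟶ Z} (hf : IsEqToHom f) (hg : IsEqToHom g) :
    IsEqToHom (f ≫ g) := by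
  obtain ⟨rfl, rfl⟩ := hf
  obtain ⟨rfl, rfl⟩ := hg
  exact ⟨rfl, Category.id_comp _⟩

lemma map (F : C ⥤ D) {X Y : C} {f : X ⟶ Y} (hf : IsEqToHom f) : IsEqToHom (F.map f) := by
  obtain ⟨rfl, rfl⟩ := hf
  exact ⟨rfl, F.map_id _⟩

lemma inv {X Y : C} {e : X ≅ Y} (h : IsEqToHom e.hom) : IsEqToHom e.inv := by
  obtain ⟨h, he⟩ := h
  subst h
  refine ⟨rfl, ?_⟩
  have := e.hom_inv_id
  rw [he] at this
  exact (Category.id_comp _).symm.trans this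

/-- By proof irrelevance a morphism of this kind is determined by its endpoints. Coherence equations
between such morphisms therefore need no computation. -/
lemma eq {X Y : C} {f g : X ⟶ Y} (hf : IsEqToHom f) (hg : IsEqToHom g) : f = g := by
  obtain ⟨h, rfl⟩ := hf
  obtain ⟨_, rfl⟩ := hg
  rfl

/-- Naturality against identities modulo equality says that the two functors agree on morphisms up
to `eqToHom`. Equality of functors is thus obtained from a transformation, not from a direct
comparison of values. -/
lemma natTrans {F G : C ⥤ D} (t : F ⟶ G) (h : ∀ X, IsEqToHom (t.app X)) : IsEqToHom t := by
  have e : F = G := by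
    refine CategoryTheory.Functor.ext (fun X => (h X).1) fun X Y f => ?_
    have := t.naturality f
    rw [(h X).2, (h Y).2] at this
    rw [← Category.assoc, ← this, Category.assoc, eqToHom_trans, eqToHom_refl, Category.comp_id]
  subst e
  exact ⟨rfl, NatTrans.ext (funext fun X => (h X).2)⟩

lemma app {F G : C ⥤ D} {t : F ⟶ G} (h : IsEqToHom t) (X : C) : IsEqToHom (t.app X) := by
  obtain ⟨rfl, rfl⟩ := h
  exact id _

end IsEqToHom

variable {O : Type u} [Category.{v} O] [OperadicCategory O]

lemma W.isEqToHom {a : SimplexCategory} {X Y : W O a} (f : X ⟶ Y)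
    (h : ∀ k, IsEqToHom (f.app.app k)) : IsEqToHom f := by
  obtain ⟨e, h'⟩ := IsEqToHom.natTrans f.app h
  obtain ⟨X⟩ := X
  obtain ⟨Y⟩ := Y
  dsimp only at e
  subst e
  exact ⟨rfl, W.Hom.ext h'⟩

lemma P.isEqToHom {a : SimplexCategory} {X Y : P O a} (f : X ⟶ Y) (h : IsEqToHom f.hom) :
    IsEqToHom f := by
  obtain ⟨e, h'⟩ := h
  obtain ⟨X, hX⟩ := X
  obtain ⟨Y, hY⟩ := Y
  dsimp only at e
  subst e
  exact ⟨rfl, ObjectProperty.hom_ext _ h'⟩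

/-! ### Inverses of quasibijections -/

/-- A fibre of `τ` is, by the axiom on fibres of fibre maps, a fibre of the map which `τ` induces
from a fibre of `τ ≫ σ = 𝟙 S` to a fibre of `σ`. The latter is a chosen local terminal object, so
the fibre of the induced map is its domain, which is a fibre of an identity. -/
lemma IsQuasibijection.of_comp_eq_id {T S : O} {σ : T ⟶ S} {τ : S ⟶ T}
    (hσ : IsQuasibijection σ) (h : τ ≫ σ = 𝟙 S) : IsQuasibijection τ := by
  intro i
  -- The index `i` is located inside the fibre of `σ` over its own image, which puts the fibre of
  -- `τ` over `i` in the form covered by `fibre_fibre`.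
  obtain ⟨a, ha⟩ := SkFin.exists_ε (card.map σ) (card.map σ i) i rfl
  have hc := congrArg SkFin.len (Functor.congr_obj (fibre_card S (card.map σ i)) (Over.mk σ))
  have hj := Functor.congr_obj (fibre_fibre (Over.mk σ) (card.map σ i) (Fin.cast hc.symm a))
    (Over.mk τ)
  have h' := (hσ (card.map σ i)).fibre_obj ((fibre S (card.map σ i)).map
    (Over.homMk τ : Over.mk (τ ≫ σ) ⟶ Over.mk σ)) (Fin.cast hc.symm a)
  have h'' : (fibre S (card.map σ i)).obj (Over.mk (τ ≫ σ)) =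
    (fibre T (SkFin.ε (card.map σ) (card.map σ i) a)).obj (Over.mk τ) := h'.symm.trans hj
  rw [ha, h] at h''
  rw [← h'']
  exact fibre_id S _

/-- If `σ'` reversed two points of one fibre of `f`, then `σ` would apply to the reversed pair,
whose images lie in one fibre of `g` by commutativity of the square, and would return the original
points in the wrong order. -/
lemma FibrewiseOrderPreserving.inv {T T' S S' : O} {σ : T ⟶ T'} {σ' : T' ⟶ T} {f : T ⟶ S}
    {g : T' ⟶ S'} {τ : S ⟶ S'} (h : FibrewiseOrderPreserving σ g) (h' : σ' ≫ σ = 𝟙 T')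
    (w : f ≫ τ = σ ≫ g) : FibrewiseOrderPreserving σ' f := by
  rw [fibrewiseOrderPreserving_iff] at h ⊢
  intro x y hxy e
  have hσ : ∀ z, card.map σ (card.map σ' z) = z := fun z =>
    (card_map_comp_apply σ' σ z).symm.trans
      ((congrArg (fun m => card.map m z) h').trans (card_map_id_apply z))
  have hw : ∀ z, card.map τ (card.map f z) = card.map g (card.map σ z) := fun z =>
    (card_map_comp_apply f τ z).symm.trans
      ((congrArg (fun m => card.map m z) w).trans (card_map_comp_apply σ g z))
  by_contra hlt
  have hle := h _ _ (not_le.1 hlt).le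
    ((hw _).symm.trans ((congrArg (card.map τ) e.symm).trans (hw _)))
  rw [hσ, hσ] at hle
  exact hlt (congrArg (card.map σ') (le_antisymm hxy hle)).le

/-- A morphism of `W(O)_n` is invertible if all its components are. -/
lemma W.isIso {a : SimplexCategory} {X Y : W O a} (f : X ⟶ Y)
    (h : ∀ k, IsIso (f.app.app k)) : IsIso f := by
  have : IsIso f.app := NatIso.isIso_of_isIso_app _
  -- This one-sided identity suffices for both conditions on the inverse ladder.
  have hk : ∀ k, (CategoryTheory.inv f.app).app k ≫ f.app.app k = 𝟙 _ := fun k => by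
    rw [← NatTrans.comp_app, IsIso.inv_hom_id, NatTrans.id_app]
  exact ⟨W.Hom.mk (CategoryTheory.inv f.app)
    (fun k => (f.isQuasibijection k).of_comp_eq_id (hk k))
    (fun k => (f.fibrewise k).inv (hk k) (f.app.naturality _)),
    W.Hom.ext (IsIso.hom_inv_id f.app), W.Hom.ext (IsIso.inv_hom_id f.app)⟩

lemma W.isGroupoid (hqb : ∀ (T S : O) (σ : T ⟶ S), IsQuasibijection σ → IsIso σ)
    (a : SimplexCategory) : IsGroupoid (W O a) :=
  ⟨fun f => W.isIso f fun k => hqb _ _ _ (f.isQuasibijection k)⟩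

lemma P.isGroupoid (hqb : ∀ (T S : O) (σ : T ⟶ S), IsQuasibijection σ → IsIso σ)
    (a : SimplexCategory) : IsGroupoid (P O a) := by
  have := W.isGroupoid hqb a
  refine ⟨fun f => ?_⟩
  have : IsIso ((incl O a).map f) := IsGroupoid.all_isIso _
  exact isIso_of_reflects_iso f (incl O a)

/-! ### The reflection on locally order-preserving chains -/

variable [StrictlyFactorisable O]

/-- The factorisation `ofOrd`, with first factor an identity, is fibrewise order-preserving, hence
it is the chosen one. The middle object is thereby equal to the source, not merely isomorphic to it.
-/
lemma pita_π_isEqToHom {T R : O} {f : T ⟶ R} (hf : IsOrderPreserving f) :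
    IsEqToHom (pita f).π := by
  rw [(pita_fibrewise f).eq (PitaFactorisation.ofOrd_fibrewise f hf)]
  exact IsEqToHom.id T

lemma unit_app_isEqToHom {a : SimplexCategory} {X : W O a} (hX : locallyOrderPreserving O a X) :
    IsEqToHom ((unit O a).app X) :=
  W.isEqToHom _ fun k => pita_π_isEqToHom (hX k)

/-- The reflection of the unit at a chain is an identity, even after restricting along an operator
that preserves the last element. -/
lemma refl_map_unit_isEqToHom
    (hqb : ∀ (T S : O) (σ : T ⟶ S), IsQuasibijection σ → IsIso σ)
    {a b : SimplexCategory} {α : a ⟶ b}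
    (hα : α.toOrderHom (Fin.last a.len) = Fin.last b.len) (X : W O b) :
    IsEqToHom ((refl O a).map ((W.map α).map ((unit O b).app X))) := by
  refine P.isEqToHom _ (W.isEqToHom _ fun k => ?_)
  -- The restriction of the reflected chain along `α` is still locally order-preserving, so the
  -- quasibijection on the target side of the prism is an identity.
  have hop := ((P.restrict O α hα).obj ((refl O b).obj X)).property k
  -- The image of the last vertex is generalised to `l`, so that its equality with the last vertex
  -- can be substituted. Then both sides of the prism start with the same invertible quasibijection;
  -- cancelling it leaves `ω = q`.
  have key : ∀ (l : Fin (b.len + 1)) (m : α.toOrderHom k ⟶ l), l = Fin.last _ →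
      ∀ (B : O) (ω : (pita (X.chain.map m)).mid ⟶ B)
        (q : (pita (X.chain.map (toLast (α.toOrderHom k)))).mid ⟶ B), IsEqToHom q →
      (pita (X.chain.map m)).π ≫ ω = (pita (X.chain.map (toLast (α.toOrderHom k)))).π ≫ q →
      IsEqToHom ω := by
    rintro _ m rfl B ω q hq h
    have := hqb _ _ _ (pita (X.chain.map m)).isQuasibijection
    rwa [(cancel_epi (pita (X.chain.map m)).π).1 h]
  exact key _ _ hα _ _ _ (pita_π_isEqToHom hop)
    (π_reflApp ((W.map α).map ((unit O b).app X)) k)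

/-- The reflection is strictly left inverse to the inclusion. -/
lemma incl_comp_refl (a : SimplexCategory) : incl O a ⋙ refl O a = 𝟭 (P O a) := by
  -- The unit, corestricted to the full subcategory. All its components are identities, which forces
  -- the two functors to be equal.
  let t : 𝟭 (P O a) ⟶ incl O a ⋙ refl O a :=
    { app := fun X => ObjectProperty.homMk ((unit O a).app X.obj)
      naturality := fun _ _ f => ObjectProperty.hom_ext _ ((unit O a).naturality f.hom) }
  exact (IsEqToHom.natTrans t fun X => P.isEqToHom _ (unit_app_isEqToHom X.property)).1.symm

/-! ### The pita nerve -/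

section

variable (hqb : ∀ (T S : O) (σ : T ⟶ S), IsQuasibijection σ → IsIso σ)

/-- The unit of the reflection is invertible if all quasibijections are. -/
noncomputable def unitIso (a : SimplexCategory) : 𝟭 (W O a) ≅ refl O a ⋙ incl O a :=
  have := W.isGroupoid hqb a
  have (X : W O a) : IsIso ((unit O a).app X) := IsGroupoid.all_isIso _
  have : IsIso (unit O a) := NatIso.isIso_of_isIso_app _
  asIso (unit O a)

/-- The reflection of a locally order-preserving chain is isomorphic to the chain. -/
noncomputable def counitIso (a : SimplexCategory) : incl O a ⋙ refl O a ≅ 𝟭 (P O a) :=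
  NatIso.ofComponents
    (fun X => ObjectProperty.isoMk _ ((unitIso hqb a).app X.obj).symm)
    (fun f => ObjectProperty.hom_ext _ ((unitIso hqb a).inv.naturality f.hom))

lemma counitIso_isEqToHom (a : SimplexCategory) (X : P O a) :
    IsEqToHom ((counitIso hqb a).hom.app X) :=
  P.isEqToHom _ (IsEqToHom.inv (e := (unitIso hqb a).app X.obj) (unit_app_isEqToHom X.property))

variable (O) in
/-- The operator on `P(O)` attached to `α`: include in `W(O)`, act there, and reflect back. -/
noncomputable def pitaMap {a b : SimplexCategory} (α : a ⟶ b) : P O b ⥤ P O a :=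
  incl O b ⋙ W.map α ⋙ refl O a

/-- The composition constraint, given by the unit of the reflection. -/
noncomputable def pitaMapComp {a b c : SimplexCategory} (α : a ⟶ b) (γ : b ⟶ c) :
    pitaMap O (α ≫ γ) ≅ pitaMap O γ ⋙ pitaMap O α :=
  Functor.isoWhiskerLeft (incl O c ⋙ W.map γ)
    (Functor.isoWhiskerRight (unitIso hqb b) (W.map α ⋙ refl O a))

lemma pitaMapComp_hom_app {a b c : SimplexCategory} (α : a ⟶ b) (γ : b ⟶ c) (x : P O c) :
    (pitaMapComp hqb α γ).hom.app x =
      (refl O a).map ((W.map α).map ((unit O b).app ((W.map γ).obj x.obj))) :=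
  rfl

/-- This is the source of all strictness in the nerve. The excluded case, where neither operator
preserves the last vertex, is where the unit can contribute a nontrivial cell. -/
lemma pitaMapComp_isEqToHom {a b c : SimplexCategory} (α : a ⟶ b) (γ : b ⟶ c)
    (h : α.toOrderHom (Fin.last a.len) = Fin.last b.len ∨
      γ.toOrderHom (Fin.last b.len) = Fin.last c.len) :
    IsEqToHom (pitaMapComp hqb α γ).hom := by
  refine IsEqToHom.natTrans _ fun X => ?_
  rw [pitaMapComp_hom_app]
  rcases h with h | h
  · exact refl_map_unit_isEqToHom hqb h _
  · exact ((unit_app_isEqToHom ((P.restrict O γ h).obj X).property).map (W.map α)).map (refl O a)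

/-- The square of the composition constraints, by naturality of the unit. -/
lemma pitaMapComp_assoc {a b c d : SimplexCategory} (α : a ⟶ b) (γ : b ⟶ c) (κ : c ⟶ d)
    (x : P O d) :
    (pitaMapComp hqb (α ≫ γ) κ).hom.app x ≫
        (pitaMapComp hqb α γ).hom.app ((pitaMap O κ).obj x) =
      (pitaMapComp hqb α (γ ≫ κ)).hom.app x ≫
        (pitaMap O α).map ((pitaMapComp hqb γ κ).hom.app x) := by
  -- Naturality of the unit at level `b` is applied to the restriction along `γ` of the unit at
  -- level `c`. Strictness of `W.map` matches the outcome with the four constraints.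
  have h := congrArg (fun m => (refl O a).map ((W.map α).map m)) ((unit O b).naturality
    ((W.map γ).map ((unit O c).app ((W.map κ).obj x.obj))))
  simp only [Functor.map_comp] at h
  exact h

/-- The pita nerve. -/
noncomputable def pitaNerve : PseudoSimplicial (P O) where
  map α := pitaMap O α
  mapId a := counitIso hqb a
  mapComp α γ := pitaMapComp hqb α γ
  -- Associativity in the simplex category is definitional, so the `eqToHom` of the axiom is an
  -- identity.
  map_assoc α γ κ x :=
    (pitaMapComp_assoc hqb α γ κ x).trans (Category.id_comp _).symm
  map_id_comp {a _} α x :=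
    ((pitaMapComp_isEqToHom hqb (𝟙 a) α (.inl rfl)).app x |>.comp
      (counitIso_isEqToHom hqb a _)).eq ⟨_, rfl⟩
  map_comp_id {_ b} α x :=
    ((pitaMapComp_isEqToHom hqb α (𝟙 b) (.inr rfl)).app x |>.comp
      ((counitIso_isEqToHom hqb b x).map (pitaMap O α))).eq ⟨_, rfl⟩

/-! ### Strict operators and the cells of the simplicial identities -/

/-- The restricted chain is already locally order-preserving, so the final reflection is absorbed by
`incl_comp_refl`. -/
lemma pitaNerve_map {a b : SimplexCategory} {α : a ⟶ b}
    (hα : α.toOrderHom (Fin.last a.len) = Fin.last b.len) :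
    (pitaNerve hqb).map α = P.restrict O α hα :=
  congrArg (fun F => P.restrict O α hα ⋙ F) (incl_comp_refl a)

lemma pitaNerve_square_isIdentity {a b b' c : SimplexCategory} {α : a ⟶ b} {γ : b ⟶ c}
    {α' : a ⟶ b'} {γ' : b' ⟶ c} (w : α ≫ γ = α' ≫ γ')
    (h : α.toOrderHom (Fin.last a.len) = Fin.last b.len ∨
      γ.toOrderHom (Fin.last b.len) = Fin.last c.len)
    (h' : α'.toOrderHom (Fin.last a.len) = Fin.last b'.len ∨
      γ'.toOrderHom (Fin.last b'.len) = Fin.last c.len) :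
    IsIdentity ((pitaNerve hqb).square w).hom :=
  (pitaMapComp_isEqToHom hqb α γ h).inv.comp
    (IsEqToHom.comp ⟨congrArg _ w, rfl⟩ (pitaMapComp_isEqToHom hqb α' γ' h'))

lemma pitaNerve_triangle_isIdentity {a b : SimplexCategory} {α : a ⟶ b} {γ : b ⟶ a}
    (w : α ≫ γ = 𝟙 a) (h : γ.toOrderHom (Fin.last b.len) = Fin.last a.len) :
    IsIdentity ((pitaNerve hqb).triangle w).hom :=
  IsEqToHom.comp (IsEqToHom.inv (e := (pitaNerve hqb).mapId a)
      (IsEqToHom.natTrans _ (counitIso_isEqToHom hqb a)))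
    (IsEqToHom.comp ⟨congrArg _ w.symm, rfl⟩ (pitaMapComp_isEqToHom hqb α γ (.inr h)))

lemma δ_last_of_ne {n : ℕ} (i : Fin (n + 2)) (hi : i ≠ Fin.last (n + 1)) :
    (δ i).toOrderHom (Fin.last _) = Fin.last _ := by
  obtain ⟨i, rfl⟩ := Fin.exists_castSucc_eq.2 hi
  exact δ_castSucc_last i

lemma pitaNerve_isPitaNerve : (pitaNerve hqb).IsPitaNerve where
  map_face n i := pitaNerve_map hqb (δ_castSucc_last i)
  map_topFace n := rfl
  map_degeneracy n i := pitaNerve_map hqb (σ_last i)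
  square_top n := by
    -- The first constraint of the square is trivial, because the inner coface `δ (Fin.last (n +
    -- 1)).castSucc` is not a top one.
    have h : IsEqToHom ((pitaMapComp hqb (δ (Fin.last (n + 1)))
          (δ (Fin.last (n + 1)).castSucc)).inv ≫
        eqToHom (congrArg (fun α => pitaMap O α) (δ_comp_δ_self (i := Fin.last (n + 1))))) :=
      (pitaMapComp_isEqToHom hqb _ _ (.inr (δ_castSucc_last _))).inv.comp ⟨_, rfl⟩
    -- The equalities that precede the whiskered unit on the required side. They have the same
    -- endpoints as the composite in `h`, so the two agree.
    have h' : IsEqToHom (eqToHom (congrArg₂ (· ⋙ ·)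
        (pitaNerve_map hqb (δ_castSucc_last (Fin.last (n + 1))))
        (rfl : (pitaNerve hqb).map (δ (Fin.last (n + 1))) = topFace O n)) ≫
        eqToHom (face_comp_topFace O n)) := .comp ⟨_, rfl⟩ ⟨_, rfl⟩
    -- The surviving constraint, which is by definition the whiskered unit occurring in `β`.
    let M := (pitaMapComp hqb (δ (Fin.last (n + 1))) (δ (Fin.last (n + 1)).succ)).hom
    refine ((Category.assoc _ _ M).symm.trans
      ((congrArg (· ≫ M) (h.eq h')).trans (Category.assoc _ _ M))).trans ?_
    exact congrArg (eqToHom _ ≫ ·) (Category.comp_id _).symm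
  -- On one side `δ i.castSucc` preserves the last vertex, on the other `δ i` does, as `i` is not
  -- the last index. No condition on `j` is needed.
  square_face_face n i j h hi := pitaNerve_square_isIdentity hqb _
    (.inr (δ_castSucc_last _)) (.inl (δ_last_of_ne i hi))
  -- The face may be a top one here; the degeneracy on each side already makes the constraint
  -- trivial.
  square_face_degeneracy_of_le n i j h := pitaNerve_square_isIdentity hqb _
    (.inr (σ_last _)) (.inl (σ_last _))
  square_face_degeneracy_of_gt n i j h := pitaNerve_square_isIdentity hqb _
    (.inr (σ_last _)) (.inl (σ_last _))
  triangle_castSucc n i := pitaNerve_triangle_isIdentity hqb _ (σ_last i)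
  triangle_succ n i := pitaNerve_triangle_isIdentity hqb _ (σ_last i)
  square_degeneracy_degeneracy n i j h := pitaNerve_square_isIdentity hqb _
    (.inr (σ_last _)) (.inr (σ_last _))

end

end PitaNerve

theorem mainTheorem3 {O : Type u} [Category.{v} O] [PitaNerve.OperadicCategory O]
    [PitaNerve.StrictlyFactorisable O]
    (hqb : ∀ (T S : O) (σ : T ⟶ S), PitaNerve.IsQuasibijection σ → IsIso σ) :
    ∃ (hgpd : ∀ a : SimplexCategory, IsGroupoid (PitaNerve.P O a))
      (N : Pseudofunctor (LocallyDiscrete SimplexCategoryᵒᵖ) PitaNerve.Gpd.{v, max u v})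
      (S : PitaNerve.PseudoSimplicial (PitaNerve.P O)),
      N = S.toPseudofunctor hgpd ∧ S.IsPitaNerve :=
  ⟨PitaNerve.P.isGroupoid hqb, _, PitaNerve.pitaNerve hqb, rfl,
    PitaNerve.pitaNerve_isPitaNerve hqb⟩
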